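/- Let $\zeta_0,\zeta_1,\zeta_2,\dots$ be independent standard complex Gaussian random variables, i.e. each $\zeta_k$ has density $\pi^{-1}e^{-|w|^2}$ with respect to Lebesgue measure on $\mathbb{C}$, and let $$\psi(z)=\sum_{k=0}^{\infty}\zeta_k\frac{z^k}{\sqrt{k!}},\qquad z\in\mathbb{C},$$ be the associated random entire function (almost surely the series converges absolutely for every $z\in\mathbb{C}$). For $r>0$ let $$p(r)=\mathbb{P}\bigl(\psi(z)\neq 0\ \text{for all } z\in\mathbb{C} \text{ with } |z|\le r\bigr)$$ be the hole probability. Then there are absolute constants $c,C,r_0>0$ such that for all $r\ge r_0$ $$\exp(-Cr^4)\le p(r)\le \exp(-cr^4).$$ -/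

import Mathlib

open MeasureTheory ProbabilityTheory

/-- The standard complex Gaussian law `N_ℂ(0,1)`: density `π⁻¹ exp(-|w|²)` with respect to
Lebesgue measure on `ℂ`. -/
noncomputable def stdComplexGaussian : Measure ℂ :=
  (volume : Measure ℂ).withDensity
    (fun w => ENNReal.ofReal (Real.pi⁻¹ * Real.exp (-‖w‖ ^ 2)))

/-- The `k`-th term `ζ_k(ω) z^k / √(k!)` of the random power series. -/
noncomputable def psiTerm {Ω : Type*} (ζ : ℕ → Ω → ℂ) (ω : Ω) (z : ℂ) (k : ℕ) : ℂ :=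
  ζ k ω * (z ^ k / ((Real.sqrt (k.factorial : ℝ) : ℝ) : ℂ))

/-- The random function `ψ(z, ω) = ∑ k, ζ_k(ω) z^k / √(k!)`. -/
noncomputable def psi {Ω : Type*} (ζ : ℕ → Ω → ℂ) (ω : Ω) (z : ℂ) : ℂ :=
  ∑' k : ℕ, psiTerm ζ ω z k

/-- The event that `ψ` has no zeros in the closed disc `|z| ≤ r`. -/
def holeEvent {Ω : Type*} (ζ : ℕ → Ω → ℂ) (r : ℝ) : Set Ω :=
  {ω | ∀ z : ℂ, ‖z‖ ≤ r → psi ζ ω z ≠ 0}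

/-- The hole probability `p(r)`. -/
noncomputable def holeProb {Ω : Type*} [MeasurableSpace Ω] (P : Measure Ω)
    (ζ : ℕ → Ω → ℂ) (r : ℝ) : ℝ :=
  P.real (holeEvent ζ r)

/-!
Lower bound. If `|ζ₀| ≥ 2` and `|ζ_k| ≤ ε (3/2)^k` for all `k ≥ 1`, with `ε = exp (-2 r²) / 3`,
then the constant term dominates the series on the disc of radius `r`. For `k` beyond a multiple
of `r²` the allowed radius is large and these constraints hold together with probability
at least `1/2`; each of the remaining `O(r²)` constraints has probability at least
`exp (-O(r²))`. Independence gives `exp (-O(r⁴))` (`exp_le_measure_holeEvent`).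

Upper bound. Let `ρ² = 2N`, let `ξ` be a primitive `N`-th root of unity, and suppose that `ψ` has no
zero in the disc of radius `r = 4 ρ`, so that `r² = 32 N`.

* Off an event of probability `O(exp (-2 N²))` all coefficients satisfy `|ζ_k| ≤ 2 N (3/2)^k`, hence
  `|ψ(z)| ≤ 8 N exp (2 |z|²)`.
* A zero-free `ψ` has a holomorphic logarithm, which the Borel–Carathéodory inequality bounds
  on a smaller disc. Averaging over the points `ρ ξ ^ j` removes all Taylor coefficients whose
  index is not a multiple of `N`, so the mean of `log |ψ(ρ ξ ^ j)|` exceeds `log |ψ(0)|` by at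
  most an exponentially small multiple of `log M - log |ψ(0)|`, where `M` bounds `|ψ|`
  (`sum_log_norm_le_of_ne_zero`). Thus the product of the
  values is below `(6 N) ^ N`, only a power of `N` per point.
* The vector of values is an affine image of the block `ζ_N, …, ζ_{2N-1}`, with
  a translation depending only on the other coefficients. Its linear part has a determinant with
  `|det|² ≥ (N 2 ^ N) ^ N` (`le_norm_det_blockMatrix`), and the Gaussian density is at most
  `π ^ (-N)`. Hence the probability that the vector lies in a set `S` is at most
  `volume S / (π ^ N |det|²)` (`measure_psi_values_mem_le`).
* The set of vectors with product below `s` and entries below `M` has volume at most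
  `s ^ p (2 π M ^ (2 - p) / (2 - p)) ^ N` for `p < 2` (`volume_smallProductSet_le`). With `p` close
  to `2` the growth `M = exp (O(N))` costs little per point, and the factor `2 ^ (-N)` per point
  wins, giving `exp (-c N²) = exp (-c' r⁴)`.
-/

/-! ### The standard complex Gaussian law -/

lemma measurable_stdComplexGaussian_density :
    Measurable (fun w : ℂ => ENNReal.ofReal (Real.pi⁻¹ * Real.exp (-‖w‖ ^ 2))) := by
  fun_prop

lemma stdComplexGaussian_apply_le (s : Set ℂ) (hs : MeasurableSet s) :
    ENNReal.ofReal Real.pi * stdComplexGaussian s ≤ volume s := by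
  rw [stdComplexGaussian, withDensity_apply _ hs,
    ← lintegral_const_mul _ measurable_stdComplexGaussian_density]
  calc _ ≤ ∫⁻ _ in s, 1 := by
        refine lintegral_mono fun w => ?_
        rw [← ENNReal.ofReal_mul Real.pi_pos.le, ← mul_assoc,
          mul_inv_cancel₀ Real.pi_ne_zero, one_mul]
        simp only [ENNReal.ofReal_le_one, Real.exp_le_one_iff]
        nlinarith [sq_nonneg ‖w‖]
    _ = volume s := by simp

lemma stdComplexGaussian_closedBall_ge (c : ℂ) {ε : ℝ} (hε : 0 ≤ ε) :
    ENNReal.ofReal (ε ^ 2 * Real.exp (-(‖c‖ + ε) ^ 2)) ≤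
      stdComplexGaussian (Metric.closedBall c ε) := by
  rw [stdComplexGaussian, withDensity_apply _ Metric.isClosed_closedBall.measurableSet]
  calc ENNReal.ofReal (ε ^ 2 * Real.exp (-(‖c‖ + ε) ^ 2))
      = ENNReal.ofReal (Real.pi⁻¹ * Real.exp (-(‖c‖ + ε) ^ 2)) *
          volume (Metric.closedBall c ε) := by
        rw [Complex.volume_closedBall, ← ENNReal.ofReal_pow hε, ← NNReal.coe_real_pi]
        rw [← ENNReal.ofReal_coe_nnreal, ← ENNReal.ofReal_mul (by positivity),
          ← ENNReal.ofReal_mul (by positivity)]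
        congr 1
        have := Real.pi_ne_zero
        simp only [NNReal.coe_real_pi]
        field_simp
    _ = ∫⁻ _ in Metric.closedBall c ε,
          ENNReal.ofReal (Real.pi⁻¹ * Real.exp (-(‖c‖ + ε) ^ 2)) := by simp
    _ ≤ _ := by
        refine setLIntegral_mono measurable_stdComplexGaussian_density fun w hw => ?_
        apply ENNReal.ofReal_le_ofReal
        have h1 : ‖w‖ ≤ ‖c‖ + ε := by
          have h2 : ‖w - c‖ ≤ ε := by simpa [dist_eq_norm] using hw
          have := norm_add_le c (w - c)
          simp only [add_sub_cancel] at this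
          linarith
        gcongr

/-- Chernoff bound, from the exponential moment `∫ exp (‖w‖² / 2) = 2`. -/
lemma stdComplexGaussian_tail_le (t : ℝ) (ht : 0 ≤ t) :
    stdComplexGaussian {w | t < ‖w‖} ≤ ENNReal.ofReal (2 * Real.exp (-t ^ 2 / 2)) := by
  have hm : MeasurableSet {w : ℂ | t < ‖w‖} := measurableSet_lt measurable_const measurable_norm
  have hint : ∫ w : ℂ, Real.exp (-(1 / 2) * ‖w‖ ^ 2) = 2 * Real.pi := by
    rw [GaussianFourier.integral_rexp_neg_mul_sq_norm (by norm_num)]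
    simp [Complex.finrank_real_complex]
    ring
  have hi : Integrable fun w : ℂ => Real.exp (-(1 / 2) * ‖w‖ ^ 2) := by
    by_contra h
    rw [integral_undef h] at hint
    linarith [Real.pi_pos]
  rw [stdComplexGaussian, withDensity_apply _ hm]
  calc _ ≤ ∫⁻ w in {w : ℂ | t < ‖w‖}, ENNReal.ofReal
            (Real.pi⁻¹ * Real.exp (-t ^ 2 / 2) * Real.exp (-(1 / 2) * ‖w‖ ^ 2)) := by
        refine setLIntegral_mono (by fun_prop) fun w hw => ?_
        apply ENNReal.ofReal_le_ofReal
        rw [mul_assoc, ← Real.exp_add]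
        have hw' : t < ‖w‖ := hw
        gcongr
        nlinarith
    _ ≤ ∫⁻ w : ℂ, ENNReal.ofReal
            (Real.pi⁻¹ * Real.exp (-t ^ 2 / 2) * Real.exp (-(1 / 2) * ‖w‖ ^ 2)) :=
        setLIntegral_le_lintegral _ _
    _ = _ := by
        rw [← ofReal_integral_eq_lintegral_ofReal (hi.const_mul _)
          (Filter.Eventually.of_forall fun w => by positivity), integral_const_mul, hint]
        congr 1
        have := Real.pi_ne_zero
        field_simp

/-! ### The random power series -/

/-- Comparison with the exponential series at `4 x ^ 2`. -/
lemma pow_div_sqrt_factorial_le (x : ℝ) (k : ℕ) :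
    x ^ k / Real.sqrt (k.factorial : ℝ) ≤ Real.exp (2 * x ^ 2) * (1 / 2) ^ k := by
  have hpos : (0 : ℝ) < k.factorial := by exact_mod_cast k.factorial_pos
  have h1 : (4 * x ^ 2) ^ k / (k.factorial : ℝ) ≤ Real.exp (4 * x ^ 2) :=
    Real.pow_div_factorial_le_exp _ (by positivity) k
  refine le_of_sq_le_sq ?_ (by positivity)
  rw [div_pow, Real.sq_sqrt hpos.le, mul_pow, ← Real.exp_nat_mul]
  have h2 : (4 * x ^ 2) ^ k = 4 ^ k * (x ^ k) ^ 2 := by rw [mul_pow, ← pow_mul, ← pow_mul, mul_comm 2]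
  have h3 : (((1 : ℝ) / 2) ^ k) ^ 2 = (4 ^ k)⁻¹ := by
    rw [← pow_mul, mul_comm k 2, pow_mul, ← inv_pow]; norm_num
  rw [h2, mul_div_assoc] at h1
  rw [h3, show ((2 : ℕ) : ℝ) * (2 * x ^ 2) = 4 * x ^ 2 by push_cast; ring, ← div_eq_mul_inv,
    le_div_iff₀ (by positivity)]
  linarith

section Series

variable {Ω : Type*} {ζ : ℕ → Ω → ℂ} {ω : Ω}

lemma norm_psiTerm (ζ : ℕ → Ω → ℂ) (ω : Ω) (z : ℂ) (k : ℕ) :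
    ‖psiTerm ζ ω z k‖ = ‖ζ k ω‖ * (‖z‖ ^ k / Real.sqrt (k.factorial : ℝ)) := by
  simp [psiTerm, abs_of_nonneg (Real.sqrt_nonneg _)]

lemma norm_psiTerm_le {T : ℝ} {k : ℕ} (h : ‖ζ k ω‖ ≤ T * (3 / 2) ^ k) (z : ℂ) :
    ‖psiTerm ζ ω z k‖ ≤ T * Real.exp (2 * ‖z‖ ^ 2) * (3 / 4) ^ k := by
  rw [norm_psiTerm]
  calc _ ≤ (T * (3 / 2) ^ k) * (Real.exp (2 * ‖z‖ ^ 2) * (1 / 2) ^ k) := by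
        gcongr
        · exact (norm_nonneg _).trans h
        · exact pow_div_sqrt_factorial_le ‖z‖ k
    _ = T * Real.exp (2 * ‖z‖ ^ 2) * ((3 / 2) ^ k * (1 / 2) ^ k) := by ring
    _ = _ := by rw [← mul_pow]; norm_num

lemma hasSum_three_quarters_pow (a : ℝ) : HasSum (fun k : ℕ => a * (3 / 4) ^ k) (4 * a) := by
  have := (hasSum_geometric_of_lt_one (r := (3 / 4 : ℝ)) (by norm_num) (by norm_num)).mul_left a
  have e : a * (1 - 3 / 4)⁻¹ = 4 * a := by norm_num; ring
  rwa [e] at this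

lemma summable_psiTerm_of_norm_le {T : ℝ} (h : ∀ k, ‖ζ k ω‖ ≤ T * (3 / 2) ^ k) (z : ℂ) :
    Summable (psiTerm ζ ω z) :=
  Summable.of_norm_bounded (hasSum_three_quarters_pow _).summable fun k => norm_psiTerm_le (h k) z

lemma norm_psi_le {T : ℝ} (h : ∀ k, ‖ζ k ω‖ ≤ T * (3 / 2) ^ k) (z : ℂ) :
    ‖psi ζ ω z‖ ≤ 4 * (T * Real.exp (2 * ‖z‖ ^ 2)) :=
  tsum_of_norm_bounded (hasSum_three_quarters_pow _) fun k => norm_psiTerm_le (h k) z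

lemma psi_zero (ζ : ℕ → Ω → ℂ) (ω : Ω) : psi ζ ω 0 = ζ 0 ω := by
  rw [psi, tsum_eq_single 0]
  · simp [psiTerm]
  · intro k hk
    simp [psiTerm, hk]

/-- A dominant constant term forces a hole. -/
lemma psi_ne_zero_of_dominant {ε r : ℝ} (h0 : 2 ≤ ‖ζ 0 ω‖)
    (h : ∀ k, ‖ζ (k + 1) ω‖ ≤ ε * (3 / 2) ^ (k + 1)) (hε : 3 * (ε * Real.exp (2 * r ^ 2)) ≤ 1)
    {z : ℂ} (hz : ‖z‖ ≤ r) : psi ζ ω z ≠ 0 := by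
  have hε0 : 0 ≤ ε := by
    have := (norm_nonneg _).trans (h 0)
    norm_num at this
    exact this
  set a := ε * Real.exp (2 * ‖z‖ ^ 2) * (3 / 4) with ha
  have hb : ∀ k, ‖psiTerm ζ ω z (k + 1)‖ ≤ a * (3 / 4) ^ k := fun k => by
    have := norm_psiTerm_le (h k) z
    rw [ha]
    rw [pow_succ (3 / 4 : ℝ)] at this
    linarith
  have hs : Summable (fun k => psiTerm ζ ω z (k + 1)) :=
    Summable.of_norm_bounded (hasSum_three_quarters_pow a).summable hb
  have hs' : Summable (psiTerm ζ ω z) := (summable_nat_add_iff 1).1 hs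
  have htail : ‖∑' k, psiTerm ζ ω z (k + 1)‖ ≤ 4 * a :=
    tsum_of_norm_bounded (hasSum_three_quarters_pow a) hb
  have ha1 : 4 * a ≤ 1 := by
    have : Real.exp (2 * ‖z‖ ^ 2) ≤ Real.exp (2 * r ^ 2) := by gcongr
    have := mul_le_mul_of_nonneg_left this hε0
    rw [ha]; linarith
  intro h00
  rw [psi, hs'.tsum_eq_zero_add] at h00
  have h1 : psiTerm ζ ω z 0 = ζ 0 ω := by simp [psiTerm]
  rw [h1] at h00
  have := eq_neg_of_add_eq_zero_left h00
  rw [this, norm_neg] at h0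
  linarith

lemma differentiable_psi (h : ∀ z, Summable (psiTerm ζ ω z)) : Differentiable ℂ (psi ζ ω) := by
  intro z
  set R := ‖z‖ + 1 with hR
  have hR0 : 0 ≤ R := by positivity
  have hd : DifferentiableOn ℂ (fun w => ∑' k, psiTerm ζ ω w k) (Metric.ball 0 R) := by
    refine Complex.differentiableOn_tsum_of_summable_norm (h R).norm (fun k => ?_)
      Metric.isOpen_ball fun k w hw => ?_
    · unfold psiTerm
      fun_prop
    · rw [norm_psiTerm, norm_psiTerm]
      have : ‖w‖ ≤ ‖(R : ℂ)‖ := by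
        rw [Complex.norm_real, Real.norm_of_nonneg hR0]
        simpa using (Metric.mem_ball.1 hw).le
      gcongr
  exact (hd z (by simp [hR])).differentiableAt (Metric.isOpen_ball.mem_nhds (by simp [hR]))

end Series

section Tail

variable {Ω : Type*} [MeasurableSpace Ω] {P : Measure Ω} {ζ : ℕ → Ω → ℂ}

lemma measure_exists_coeff_large_le (hζ : ∀ k, HasLaw (ζ k) stdComplexGaussian P) (m : ℕ) {T : ℝ}
    (hT : 2 ≤ T) :
    P {ω | ∃ k, T * (3 / 2) ^ k < ‖ζ (m + k) ω‖} ≤ ENNReal.ofReal (4 * Real.exp (-T ^ 2 / 2)) := by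
  set q := Real.exp (-T ^ 2 / 2) with hq
  have hq2 : q ≤ 1 / 2 := by
    have h1 : -T ^ 2 / 2 ≤ -1 := by nlinarith
    exact (Real.exp_le_exp.2 h1).trans (by linarith [Real.exp_neg_one_lt_half])
  have hq0 : 0 < q := Real.exp_pos _
  have hone : ∀ k, P {ω | T * (3 / 2) ^ k < ‖ζ (m + k) ω‖} ≤ ENNReal.ofReal (2 * q * q ^ k) := by
    intro k
    have hms : MeasurableSet {w : ℂ | T * (3 / 2) ^ k < ‖w‖} :=
      measurableSet_lt measurable_const measurable_norm
    rw [(hζ (m + k)).measure_eq hms]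
    refine (stdComplexGaussian_tail_le _ (by positivity)).trans ?_
    apply ENNReal.ofReal_le_ofReal
    rw [mul_assoc, ← pow_succ', hq, ← Real.exp_nat_mul]
    gcongr
    have h94 : 1 + (k : ℝ) * (5 / 4) ≤ (1 + 5 / 4) ^ k := one_add_mul_le_pow (by norm_num) k
    have h3 : ((3 / 2 : ℝ) ^ k) ^ 2 = (1 + 5 / 4) ^ k := by
      rw [← pow_mul, mul_comm, pow_mul]; norm_num
    rw [mul_pow, h3]
    push_cast
    have hk : (0 : ℝ) ≤ k := by positivity
    nlinarith [mul_le_mul_of_nonneg_left h94 (sq_nonneg T), mul_nonneg (sq_nonneg T) hk]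
  have hsum : HasSum (fun k : ℕ => 2 * q * q ^ k) (2 * q * (1 - q)⁻¹) :=
    (hasSum_geometric_of_lt_one hq0.le (by linarith)).mul_left _
  have hset : {ω | ∃ k, T * (3 / 2) ^ k < ‖ζ (m + k) ω‖} =
      ⋃ k, {ω | T * (3 / 2) ^ k < ‖ζ (m + k) ω‖} := by ext; simp
  rw [hset]
  calc _ ≤ ∑' k, P {ω | T * (3 / 2) ^ k < ‖ζ (m + k) ω‖} := measure_iUnion_le _
    _ ≤ ∑' k, ENNReal.ofReal (2 * q * q ^ k) := ENNReal.tsum_le_tsum hone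
    _ = ENNReal.ofReal (2 * q * (1 - q)⁻¹) := by
        rw [← ENNReal.ofReal_tsum_of_nonneg (fun k => by positivity) hsum.summable, hsum.tsum_eq]
    _ ≤ _ := by
        apply ENNReal.ofReal_le_ofReal
        have : (1 - q)⁻¹ ≤ 2 := by
          rw [inv_le_comm₀ (by linarith) (by norm_num)]; linarith
        nlinarith

lemma ae_exists_coeff_bound (hζ : ∀ k, HasLaw (ζ k) stdComplexGaussian P) :
    ∀ᵐ ω ∂P, ∃ T : ℝ, ∀ k, ‖ζ k ω‖ ≤ T * (3 / 2) ^ k := by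
  rw [ae_iff]
  have hle : ∀ n : ℕ, P {ω | ¬ ∃ T : ℝ, ∀ k, ‖ζ k ω‖ ≤ T * (3 / 2) ^ k} ≤
      ENNReal.ofReal (4 * Real.exp (-(n + 2 : ℝ) ^ 2 / 2)) := fun n => by
    refine le_trans (measure_mono fun ω hω => ?_)
      (measure_exists_coeff_large_le hζ 0 (T := n + 2) (by linarith [(n.cast_nonneg : (0:ℝ) ≤ n)]))
    simp only [Set.mem_ofPred_eq, not_exists, not_forall, not_le] at hω ⊢
    simpa using hω (n + 2)
  have hlim : Filter.Tendsto (fun n : ℕ => ENNReal.ofReal (4 * Real.exp (-(n + 2 : ℝ) ^ 2 / 2)))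
      Filter.atTop (nhds 0) := by
    have h1 : Filter.Tendsto (fun n : ℕ => 4 * Real.exp (-(n : ℝ))) Filter.atTop (nhds (4 * 0)) :=
      (Real.tendsto_exp_neg_atTop_nhds_zero.comp tendsto_natCast_atTop_atTop).const_mul 4
    rw [mul_zero] at h1
    have h2 := ENNReal.tendsto_ofReal h1
    rw [ENNReal.ofReal_zero] at h2
    refine tendsto_of_tendsto_of_tendsto_of_le_of_le tendsto_const_nhds h2
      (fun _ => zero_le) fun n => ?_
    apply ENNReal.ofReal_le_ofReal
    have hn : (0 : ℝ) ≤ n := n.cast_nonneg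
    gcongr
    nlinarith
  exact le_antisymm (ge_of_tendsto' hlim hle) zero_le

lemma ae_summable_psiTerm (hζ : ∀ k, HasLaw (ζ k) stdComplexGaussian P) :
    ∀ᵐ ω ∂P, ∀ z, Summable (psiTerm ζ ω z) := by
  filter_upwards [ae_exists_coeff_bound hζ] with ω ⟨T, hT⟩ z
  exact summable_psiTerm_of_norm_le hT z

end Tail

/-! ### Measurability of the hole event -/

section Measurability

variable {Ω : Type*} [MeasurableSpace Ω] {P : Measure Ω} {ζ : ℕ → Ω → ℂ}

lemma aemeasurable_psiTerm (hζ : ∀ k, HasLaw (ζ k) stdComplexGaussian P) (z : ℂ) (k : ℕ) :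
    AEMeasurable (fun ω => psiTerm ζ ω z k) P :=
  (hζ k).aemeasurable.mul_const _

lemma aemeasurable_psi (hζ : ∀ k, HasLaw (ζ k) stdComplexGaussian P) (z : ℂ) :
    AEMeasurable (fun ω => psi ζ ω z) P := by
  refine aemeasurable_of_tendsto_metrizable_ae Filter.atTop
    (f := fun n ω => ∑ k ∈ Finset.range n, psiTerm ζ ω z k)
    (fun n => Finset.aemeasurable_fun_sum _ fun k _ => aemeasurable_psiTerm hζ z k) ?_
  filter_upwards [ae_summable_psiTerm hζ] with ω hω
  exact (hω z).hasSum.tendsto_sum_nat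

/-- By continuity of `ψ` and compactness of the disc, the hole event agrees almost surely with
the event that `|ψ|` has a positive lower bound on a countable dense subset of the disc. -/
lemma nullMeasurableSet_holeEvent (hζ : ∀ k, HasLaw (ζ k) stdComplexGaussian P) (r : ℝ) :
    NullMeasurableSet (holeEvent ζ r) P := by
  rcases lt_or_ge r 0 with hr | hr
  -- For negative `r` the disc is empty.
  · have : holeEvent ζ r = Set.univ := by
      ext ω
      simp only [holeEvent, Set.mem_ofPred_eq, Set.mem_univ, iff_true]
      intro z hz
      linarith [norm_nonneg z]
    rw [this]
    exact .univ
  have : Nonempty (Metric.closedBall (0 : ℂ) r) := ⟨⟨0, by simpa using hr⟩⟩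
  set u : ℕ → Metric.closedBall (0 : ℂ) r := TopologicalSpace.denseSeq _ with hu
  have hmeas : NullMeasurableSet
      (⋃ m : ℕ, ⋂ i : ℕ, {ω | 1 / ((m : ℝ) + 1) ≤ ‖psi ζ ω (u i)‖}) P :=
    .iUnion fun m => .iInter fun i =>
      nullMeasurableSet_le aemeasurable_const (aemeasurable_psi hζ _).norm
  refine hmeas.congr ?_
  rw [Filter.eventuallyEq_set]
  filter_upwards [ae_summable_psiTerm hζ] with ω hω
  have hcont : Continuous fun z : Metric.closedBall (0 : ℂ) r => ‖psi ζ ω z‖ :=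
    ((differentiable_psi hω).continuous.comp continuous_subtype_val).norm
  simp only [Set.mem_iUnion, Set.mem_iInter, Set.mem_ofPred_eq, holeEvent]
  constructor
  · rintro ⟨m, hm⟩ z hz h0
    have hcl : IsClosed {z : Metric.closedBall (0 : ℂ) r | 1 / ((m : ℝ) + 1) ≤ ‖psi ζ ω z‖} :=
      isClosed_le continuous_const hcont
    have hd := (TopologicalSpace.denseRange_denseSeq (Metric.closedBall (0 : ℂ) r))
    have huniv : closure (Set.range u) ⊆ _ :=
      closure_minimal (by rintro _ ⟨i, rfl⟩; exact hm i) hcl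
    have := huniv (hd ⟨z, by simpa using hz⟩)
    simp only [Set.mem_ofPred_eq, h0, norm_zero] at this
    have hp : (0 : ℝ) < 1 / ((m : ℝ) + 1) := by positivity
    linarith
  · intro h
    obtain ⟨z₀, hz₀⟩ := hcont.exists_forall_le_of_hasCompactSupport
      (HasCompactSupport.of_compactSpace _)
    obtain ⟨m, hm⟩ := exists_nat_one_div_lt (norm_pos_iff.2 (h z₀ (mem_closedBall_zero_iff.1 z₀.2)))
    exact ⟨m, fun i => hm.le.trans (hz₀ _)⟩

end Measurability

/-! ### The lower bound -/

section LowerBound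

lemma nine_le_exp_three : 9 ≤ Real.exp 3 := by
  have h1 : (2.7 : ℝ) ≤ Real.exp 1 := by linarith [Real.exp_one_gt_d9]
  have h2 : Real.exp 3 = Real.exp 1 ^ 3 := by rw [Real.exp_one_pow]; norm_num
  rw [h2]
  calc (9 : ℝ) ≤ 2.7 ^ 3 := by norm_num
    _ ≤ _ := by gcongr

lemma exp_neg_three_le : Real.exp (-3) ≤ 1 / 9 := by
  rw [Real.exp_neg, one_div]
  exact inv_anti₀ (by norm_num) nine_le_exp_three

variable {Ω : Type*} [MeasurableSpace Ω] {P : Measure Ω} [IsProbabilityMeasure P]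
  {ζ : ℕ → Ω → ℂ}

/-- The tail factors together cost only a constant, as the radii grow geometrically. -/
lemma half_mul_prod_le_measure_coeff_mem (hζ : ∀ k, HasLaw (ζ k) stdComplexGaussian P)
    (hind : iIndepFun ζ P) {S : ℕ → Set ℂ} (hS : ∀ k, MeasurableSet (S k)) {m : ℕ} {T : ℝ}
    (hT : 3 ≤ T) (htail : ∀ k, Metric.closedBall 0 (T * (3 / 2) ^ k) ⊆ S (m + k)) :
    2⁻¹ * ∏ k ∈ Finset.range m, stdComplexGaussian (S k) ≤ P {ω | ∀ k, ζ k ω ∈ S k} := by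
  have hprod : ∀ s : Finset ℕ, P (⋂ k ∈ s, ζ k ⁻¹' S k) = ∏ k ∈ s, stdComplexGaussian (S k) :=
    fun s => by
      rw [hind.measure_inter_preimage_eq_mul s fun k _ => hS k]
      exact Finset.prod_congr rfl fun k _ => (hζ k).measure_eq (hS k)
  have hnull : ∀ k, NullMeasurableSet (ζ k ⁻¹' S k) P := fun k =>
    (hζ k).aemeasurable.nullMeasurable (hS k)
  have htl : (2 : ENNReal)⁻¹ ≤ P {ω | ∀ k, ζ (m + k) ω ∈ S (m + k)} := by
    have h1 : P {ω | ∀ k, ζ (m + k) ω ∈ S (m + k)}ᶜ ≤ 2⁻¹ := by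
      refine (measure_mono (fun ω hω => ?_)).trans
        ((measure_exists_coeff_large_le hζ m (T := T) (by linarith)).trans ?_)
      · simp only [Set.mem_compl_iff, Set.mem_ofPred_eq, not_forall] at hω ⊢
        obtain ⟨k, hk⟩ := hω
        refine ⟨k, ?_⟩
        by_contra hcon
        exact hk (htail k (by simpa using hcon))
      · have h2 : Real.exp (-T ^ 2 / 2) ≤ Real.exp (-3) := by
          gcongr; nlinarith
        have h3 := exp_neg_three_le
        calc ENNReal.ofReal (4 * Real.exp (-T ^ 2 / 2)) ≤ ENNReal.ofReal (2⁻¹) := by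
              apply ENNReal.ofReal_le_ofReal; linarith
          _ = 2⁻¹ := by rw [ENNReal.ofReal_inv_of_pos (by norm_num)]; norm_num
    have hn : NullMeasurableSet {ω | ∀ k, ζ (m + k) ω ∈ S (m + k)} P := by
      have : {ω | ∀ k, ζ (m + k) ω ∈ S (m + k)} = ⋂ k, ζ (m + k) ⁻¹' S (m + k) := by
        ext; simp
      rw [this]
      exact .iInter fun k => hnull _
    have h2 := measure_add_measure_compl₀ hn
    rw [measure_univ] at h2
    have h3 : 1 - (2 : ENNReal)⁻¹ ≤ P {ω | ∀ k, ζ (m + k) ω ∈ S (m + k)} := by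
      rw [tsub_le_iff_right, ← h2]
      gcongr
    rwa [ENNReal.one_sub_inv_two] at h3
  have hfin : ∀ n, 2⁻¹ * ∏ k ∈ Finset.range m, stdComplexGaussian (S k) ≤
      P (⋂ k ∈ Finset.range (m + n), ζ k ⁻¹' S k) := fun n => by
    have hsplit : ∏ k ∈ Finset.range (m + n), stdComplexGaussian (S k) =
        (∏ k ∈ Finset.range m, stdComplexGaussian (S k)) *
          ∏ k ∈ Finset.Ico m (m + n), stdComplexGaussian (S k) :=
      (Finset.prod_range_mul_prod_Ico _ (Nat.le_add_right m n)).symm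
    rw [hprod, hsplit, mul_comm]
    gcongr
    rw [← hprod]
    refine htl.trans (measure_mono fun ω hω => ?_)
    simp only [Set.mem_iInter, Finset.mem_Ico, Set.mem_preimage]
    intro k hk
    have := hω (k - m)
    rwa [Nat.add_sub_cancel' hk.1] at this
  have hset : {ω | ∀ k, ζ k ω ∈ S k} = ⋂ n, ⋂ k ∈ Finset.range (m + n), ζ k ⁻¹' S k := by
    ext ω
    simp only [Set.mem_ofPred_eq, Set.mem_iInter, Finset.mem_range, Set.mem_preimage]
    exact ⟨fun h _ k _ => h k, fun h k => h (k + 1) k (by omega)⟩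
  have hanti : Antitone fun n => ⋂ k ∈ Finset.range (m + n), ζ k ⁻¹' S k := by
    intro a b hab
    exact Set.biInter_subset_biInter_left fun k hk => by
      simp only [Finset.mem_range, SetLike.mem_coe] at hk ⊢
      omega
  rw [hset]
  exact ge_of_tendsto'
    (tendsto_measure_iInter_atTop (fun n => .biInter (Finset.countable_toSet _) fun k _ => hnull k)
      hanti ⟨0, measure_ne_top _ _⟩) hfin

/-- The hole is forced by `|ζ₀| ≥ 2` and `|ζ_k| ≤ ε (3/2)^k` for `k ≥ 1` with
`ε = exp (-2 r²) / 3`; only the first `O(r²)` of these constraints cost a factor `exp (-O(r²))`. -/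
lemma exp_le_measure_holeEvent (hζ : ∀ k, HasLaw (ζ k) stdComplexGaussian P)
    (hind : iIndepFun ζ P) {r : ℝ} (hr : 1 ≤ r) :
    ENNReal.ofReal (Real.exp (-415 * r ^ 4)) ≤ P (holeEvent ζ r) := by
  have hr2 : 1 ≤ r ^ 2 := by nlinarith
  set ε := Real.exp (-2 * r ^ 2) / 3 with hε
  have hε0 : 0 < ε := by positivity
  have hε1 : ε ≤ 1 := by
    have : Real.exp (-2 * r ^ 2) ≤ 1 := Real.exp_le_one_iff.2 (by nlinarith)
    rw [hε]; linarith
  set S : ℕ → Set ℂ := fun k =>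
    if k = 0 then Metric.closedBall 3 1 else Metric.closedBall 0 (ε * (3 / 2) ^ k) with hS
  obtain ⟨m, hm1, hm2⟩ : ∃ m : ℕ, 2 * r ^ 2 + 3 ≤ m ∧ (m : ℝ) ≤ 6 * r ^ 2 := by
    refine ⟨⌈2 * r ^ 2 + 3⌉₊, Nat.le_ceil _, ?_⟩
    have := (Nat.ceil_lt_add_one (show 0 ≤ 2 * r ^ 2 + 3 by positivity)).le
    linarith
  have hm0 : m ≠ 0 := by
    rintro rfl
    norm_num at hm1
    linarith
  -- `(3 / 2) ^ 3 > e`, so a block of `3 m` indices raises the radius from `ε` above `3`.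
  have hT : 3 ≤ ε * (3 / 2) ^ (3 * m) := by
    have h1 : Real.exp m ≤ (3 / 2) ^ (3 * m) := by
      rw [pow_mul, ← Real.exp_one_pow]
      gcongr
      have := Real.exp_one_lt_d9
      norm_num; linarith
    have h2 : 9 * Real.exp (2 * r ^ 2) ≤ Real.exp m := by
      have h3 : Real.exp (2 * r ^ 2 + 3) ≤ Real.exp m := Real.exp_le_exp.2 hm1
      have h4 := nine_le_exp_three
      rw [Real.exp_add] at h3
      nlinarith [Real.exp_pos (2 * r ^ 2)]
    have h7 : Real.exp (-2 * r ^ 2) * Real.exp (2 * r ^ 2) = 1 := by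
      rw [← Real.exp_add]; simp
    calc (3 : ℝ) = ε * (9 * Real.exp (2 * r ^ 2)) := by rw [hε]; linarith
      _ ≤ _ := by gcongr; linarith
  have hSm : ∀ k, MeasurableSet (S k) := fun k => by
    simp only [hS]; split_ifs <;> exact Metric.isClosed_closedBall.measurableSet
  have key := half_mul_prod_le_measure_coeff_mem (m := 3 * m) hζ hind hSm hT fun k => by
    simp only [hS, show 3 * m + k ≠ 0 by omega, if_false]
    rw [mul_assoc, ← pow_add]
  have hfactor : ∀ k, ENNReal.ofReal (Real.exp (-23 * r ^ 2)) ≤ stdComplexGaussian (S k) := by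
    intro k
    simp only [hS]
    split_ifs with hk
    · refine le_trans ?_ (stdComplexGaussian_closedBall_ge 3 zero_le_one)
      apply ENNReal.ofReal_le_ofReal
      norm_num
      nlinarith
    · refine le_trans ?_ ((stdComplexGaussian_closedBall_ge 0 hε0.le).trans
        (measure_mono (Metric.closedBall_subset_closedBall ?_)))
      · apply ENNReal.ofReal_le_ofReal
        have h1 := exp_neg_three_le
        have h2 : ε ^ 2 = Real.exp (-4 * r ^ 2) * (1 / 9) := by
          rw [hε, div_pow, ← Real.exp_nat_mul]
          push_cast; ring_nf
        rw [h2]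
        calc Real.exp (-23 * r ^ 2) ≤ Real.exp (-4 * r ^ 2 + -3 + -(‖(0 : ℂ)‖ + ε) ^ 2) := by
              rw [norm_zero, zero_add]
              gcongr
              nlinarith
          _ = Real.exp (-4 * r ^ 2) * Real.exp (-3) * Real.exp (-(‖(0 : ℂ)‖ + ε) ^ 2) := by
              rw [Real.exp_add, Real.exp_add]
          _ ≤ _ := by gcongr
      · exact le_mul_of_one_le_right hε0.le (one_le_pow₀ (by norm_num))
  have hprod : ENNReal.ofReal (Real.exp (-414 * r ^ 4)) ≤
      ∏ k ∈ Finset.range (3 * m), stdComplexGaussian (S k) := by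
    calc ENNReal.ofReal (Real.exp (-414 * r ^ 4))
        ≤ ENNReal.ofReal (Real.exp (-23 * r ^ 2)) ^ (3 * m) := by
          rw [← ENNReal.ofReal_pow (Real.exp_pos _).le, ← Real.exp_nat_mul]
          apply ENNReal.ofReal_le_ofReal
          apply Real.exp_le_exp.2
          push_cast
          nlinarith [mul_le_mul_of_nonneg_right hm2 (sq_nonneg r)]
      _ = ∏ _k ∈ Finset.range (3 * m), ENNReal.ofReal (Real.exp (-23 * r ^ 2)) := by simp
      _ ≤ _ := Finset.prod_le_prod' fun k _ => hfactor k
  have hsub : {ω | ∀ k, ζ k ω ∈ S k} ⊆ holeEvent ζ r := by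
    intro ω hω z hz
    refine psi_ne_zero_of_dominant (ε := ε) ?_ (fun k => ?_) ?_ hz
    · have h0 := hω 0
      simp only [hS, if_true, Metric.mem_closedBall, dist_eq_norm] at h0
      have := norm_sub_norm_le (3 : ℂ) (ζ 0 ω)
      rw [norm_sub_rev] at this
      norm_num at this
      linarith
    · have h1 := hω (k + 1)
      simpa [hS] using h1
    · have h7 : Real.exp (-2 * r ^ 2) * Real.exp (2 * r ^ 2) = 1 := by
        rw [← Real.exp_add]; simp
      rw [hε]; linarith
  calc ENNReal.ofReal (Real.exp (-415 * r ^ 4))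
      ≤ ENNReal.ofReal (2⁻¹ * Real.exp (-414 * r ^ 4)) := by
        apply ENNReal.ofReal_le_ofReal
        rw [show -415 * r ^ 4 = -(r ^ 4) + -414 * r ^ 4 by ring, Real.exp_add]
        gcongr
        rw [Real.exp_neg]
        apply inv_anti₀ (by norm_num)
        have := Real.add_one_le_exp (r ^ 4)
        nlinarith
    _ = 2⁻¹ * ENNReal.ofReal (Real.exp (-414 * r ^ 4)) := by
        rw [ENNReal.ofReal_mul (by norm_num), ENNReal.ofReal_inv_of_pos (by norm_num)]
        norm_num
    _ ≤ _ := by gcongr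
    _ ≤ _ := key
    _ ≤ _ := measure_mono hsub

end LowerBound

/-! ### Averages over roots of unity -/

section Averages

lemma sum_pow_primitiveRoot_eq_zero {ξ : ℂ} {N k : ℕ} (hξ : IsPrimitiveRoot ξ N) (hk : ¬ N ∣ k) :
    ∑ j ∈ Finset.range N, (ξ ^ j) ^ k = 0 := by
  have h1 : ξ ^ k ≠ 1 := fun h => hk (hξ.dvd_of_pow_eq_one k h)
  have h2 : ∑ j ∈ Finset.range N, (ξ ^ j) ^ k = ∑ j ∈ Finset.range N, (ξ ^ k) ^ j :=
    Finset.sum_congr rfl fun j _ => by rw [← pow_mul, ← pow_mul, mul_comm]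
  rw [h2, geom_sum_eq h1, ← pow_mul, mul_comm, pow_mul, hξ.pow_eq_one]
  simp

/-- For a holomorphic function, only the Taylor coefficients whose index is a multiple of `N`
contribute to the average over `N` equidistributed points, so the mean value property
holds for this average up to an exponentially small error. -/
lemma norm_sum_primitiveRoot_sub_le {g : ℂ → ℂ} {ρ R B : ℝ} (hρ : 0 < ρ) (hR : 2 * ρ < R)
    (hg : DifferentiableOn ℂ g (Metric.ball 0 R)) (hB : ∀ z, ‖z‖ = 2 * ρ → ‖g z‖ ≤ B)
    {ξ : ℂ} {N : ℕ} (hN : N ≠ 0) (hξ : IsPrimitiveRoot ξ N) :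
    ‖∑ j ∈ Finset.range N, g (ρ * ξ ^ j) - N * g 0‖ ≤ 2 * N * B * (1 / 2) ^ N := by
  have hξ1 : ‖ξ‖ = 1 := hξ.norm'_eq_one hN
  set a : ℕ → ℂ := fun n => (n.factorial : ℂ)⁻¹ * iteratedDeriv n g 0 with ha
  have hab : ∀ n, ‖a n‖ ≤ B / (2 * ρ) ^ n := fun n => by
    have h1 := Complex.norm_iteratedDeriv_le_of_forall_mem_sphere_norm_le n
      (show 0 < 2 * ρ by positivity)
      (hg.diffContOnCl_ball (Metric.closedBall_subset_ball hR))
      (fun z hz => hB z (mem_sphere_zero_iff_norm.1 hz))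
    rw [ha]
    have hpos : (0 : ℝ) < n.factorial := by exact_mod_cast n.factorial_pos
    simp only [norm_mul, norm_inv, Complex.norm_natCast]
    rw [inv_mul_le_iff₀ hpos]
    rwa [mul_div_assoc] at h1
  set b : ℕ → ℂ := fun n => ∑ j ∈ Finset.range N, a n * (ρ * ξ ^ j) ^ n with hb
  have hsum : HasSum b (∑ j ∈ Finset.range N, g (ρ * ξ ^ j)) := by
    refine hasSum_sum fun j _ => ?_
    have hz : (ρ * ξ ^ j : ℂ) ∈ Metric.ball (0 : ℂ) R := by
      simp [hξ1, abs_of_pos hρ]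
      linarith
    have := Complex.hasSum_taylorSeries_on_ball hg hz
    simp only [sub_zero, smul_eq_mul] at this
    refine this.congr_fun fun n => ?_
    rw [ha]; ring
  have hbn : ∀ n, b n = a n * ρ ^ n * ∑ j ∈ Finset.range N, (ξ ^ j) ^ n := fun n => by
    rw [hb]
    simp only [mul_pow, Finset.mul_sum]
    exact Finset.sum_congr rfl fun j _ => by ring
  have hb0 : b 0 = N * g 0 := by
    rw [hbn]; simp [ha, mul_comm]
  have hhead : ∑ n ∈ Finset.range N, b n = N * g 0 := by
    rw [Finset.sum_eq_single 0, hb0]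
    · intro n hn hn0
      rw [hbn, sum_pow_primitiveRoot_eq_zero hξ, mul_zero]
      intro hdvd
      exact absurd (Nat.le_of_dvd (Nat.pos_of_ne_zero hn0) hdvd)
        (not_le.2 (Finset.mem_range.1 hn))
    · intro h
      simp at h
      exact absurd h hN
  have hbb : ∀ n, ‖b n‖ ≤ N * B * (1 / 2) ^ n := fun n => by
    rw [hbn, norm_mul, norm_mul]
    have h1 : ‖∑ j ∈ Finset.range N, (ξ ^ j) ^ n‖ ≤ N := by
      refine (norm_sum_le _ _).trans ?_
      simp [hξ1]
    have h2 : ‖((ρ : ℂ)) ^ n‖ = ρ ^ n := by simp [abs_of_pos hρ]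
    rw [h2]
    calc ‖a n‖ * ρ ^ n * ‖∑ j ∈ Finset.range N, (ξ ^ j) ^ n‖
        ≤ (B / (2 * ρ) ^ n) * ρ ^ n * N := by
          gcongr
          · exact mul_nonneg ((norm_nonneg _).trans (hab n)) (by positivity)
          · exact hab n
      _ = _ := by
          rw [mul_pow, one_div, inv_pow]
          field_simp
  have htail := (hasSum_nat_add_iff' N).2 hsum
  rw [hhead] at htail
  have hgeo : HasSum (fun n : ℕ => N * B * (1 / 2) ^ N * (1 / 2) ^ n)
      (N * B * (1 / 2) ^ N * 2) := hasSum_geometric_two.mul_left _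
  rw [← htail.tsum_eq]
  refine (tsum_of_norm_bounded hgeo fun n => ?_).trans (le_of_eq (by ring))
  refine (hbb (n + N)).trans (le_of_eq ?_)
  rw [pow_add]; ring

lemma exists_eq_mul_exp_of_ne_zero {F : ℂ → ℂ} (hF : Differentiable ℂ F) {R : ℝ}
    (hne : ∀ z ∈ Metric.ball (0 : ℂ) R, F z ≠ 0) :
    ∃ g : ℂ → ℂ, DifferentiableOn ℂ g (Metric.ball 0 R) ∧ g 0 = 0 ∧
      ∀ z ∈ Metric.ball (0 : ℂ) R, F z = F 0 * Complex.exp (g z) := by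
  have hq : DifferentiableOn ℂ (fun z => deriv F z / F z) (Metric.ball 0 R) :=
    (hF.contDiff (n := 2)).differentiable_deriv_two.differentiableOn.div hF.differentiableOn hne
  obtain ⟨g, hg0, hg⟩ := hq.isExactOn_ball.with_val_at 0 0
  refine ⟨g, fun z hz => (hg z hz).differentiableAt.differentiableWithinAt, hg0, fun z hz => ?_⟩
  have hd : ∀ w ∈ Metric.ball (0 : ℂ) R,
      HasDerivAt (fun w => F w * Complex.exp (-g w)) 0 w := fun w hw => by
    have h1 := (hF w).hasDerivAt.mul ((hg w hw).neg.cexp)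
    convert! h1 using 1
    have := hne w hw
    field_simp
    ring
  have hR : 0 < R := Metric.pos_of_mem_ball hz
  have hconst := (convex_ball (0 : ℂ) R).is_const_of_fderivWithin_eq_zero (𝕜 := ℂ)
    (fun w hw => (hd w hw).differentiableAt.differentiableWithinAt)
    (fun w hw => by
      rw [fderivWithin_of_isOpen Metric.isOpen_ball hw]
      ext
      simp [(hd w hw).deriv])
    hz (Metric.mem_ball_self hR)
  simp only [hg0, neg_zero, Complex.exp_zero, mul_one] at hconst
  rw [← hconst, mul_assoc, ← Complex.exp_add]
  simp

/-- An approximate Jensen formula at `N` equidistributed points, for zero-free functions: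
the Borel–Carathéodory inequality bounds the holomorphic logarithm, so the discrete mean
value property applies to it. -/
lemma sum_log_norm_le_of_ne_zero {F : ℂ → ℂ} (hF : Differentiable ℂ F) {ρ M : ℝ} (hρ : 0 < ρ)
    (hne : ∀ z, ‖z‖ ≤ 4 * ρ → F z ≠ 0) (hM : ∀ z, ‖z‖ ≤ 4 * ρ → ‖F z‖ < M)
    {ξ : ℂ} {N : ℕ} (hN : N ≠ 0) (hξ : IsPrimitiveRoot ξ N) :
    ∑ j ∈ Finset.range N, Real.log ‖F (ρ * ξ ^ j)‖ ≤
      N * (Real.log ‖F 0‖ + 4 * (1 / 2) ^ N * (Real.log M - Real.log ‖F 0‖)) := by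
  have hmem : ∀ z ∈ Metric.ball (0 : ℂ) (4 * ρ), ‖z‖ ≤ 4 * ρ := fun z hz =>
    (mem_ball_zero_iff.1 hz).le
  obtain ⟨g, hg, hg0, hgF⟩ := exists_eq_mul_exp_of_ne_zero hF fun z hz => hne z (hmem z hz)
  have hF0 : 0 < ‖F 0‖ := norm_pos_iff.2 (hne 0 (by simp; positivity))
  set A := Real.log M - Real.log ‖F 0‖ with hA
  have hApos : 0 < A := sub_pos.2 (Real.log_lt_log hF0 (hM 0 (by simp; positivity)))
  have hlog : ∀ z ∈ Metric.ball (0 : ℂ) (4 * ρ),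
      Real.log ‖F z‖ = Real.log ‖F 0‖ + (g z).re := fun z hz => by
    rw [hgF z hz, norm_mul, Complex.norm_exp, Real.log_mul hF0.ne' (Real.exp_ne_zero _),
      Real.log_exp]
  have hre : Set.MapsTo g (Metric.ball 0 (4 * ρ)) {z | z.re ≤ A} := fun z hz => by
    have h1 := hlog z hz
    have h2 := Real.log_lt_log (norm_pos_iff.2 (hne z (hmem z hz))) (hM z (hmem z hz))
    simp only [Set.mem_ofPred_eq]
    linarith
  have hB : ∀ z, ‖z‖ = 2 * ρ → ‖g z‖ ≤ 2 * A := fun z hz => by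
    have := Complex.borelCaratheodory_zero hApos hg hre (by positivity)
      (show z ∈ Metric.ball 0 (4 * ρ) by rw [mem_ball_zero_iff]; linarith) hg0
    rw [hz] at this
    refine this.trans (le_of_eq ?_)
    rw [show 4 * ρ - 2 * ρ = 2 * ρ by ring]
    field_simp
  have hav := norm_sum_primitiveRoot_sub_le hρ (by linarith) hg hB hN hξ
  rw [hg0, mul_zero, sub_zero] at hav
  have hξ1 : ‖ξ‖ = 1 := hξ.norm'_eq_one hN
  have hsum : ∑ j ∈ Finset.range N, Real.log ‖F (ρ * ξ ^ j)‖ =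
      N * Real.log ‖F 0‖ + (∑ j ∈ Finset.range N, g (ρ * ξ ^ j)).re := by
    rw [Finset.sum_congr rfl fun j _ => hlog _ ?_, Finset.sum_add_distrib, Complex.re_sum]
    · simp
    · simp [hξ1, abs_of_pos hρ]
      linarith
  rw [hsum]
  have := (Complex.re_le_norm _).trans hav
  linarith

end Averages

/-! ### Volume of the set of vectors with small product -/

section Volume

/-- The function `‖w‖ ^ (-p)` cut off at the radius `M`. Its value at the singularity `w = 0` is
the conventional one of `Real.rpow`; this is why zero entries are excluded from
`smallProductSet`. -/
noncomputable def truncNormRpow (p M : ℝ) (w : ℂ) : ℝ :=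
  (Set.Iio M).indicator (fun t : ℝ => t ^ (-p)) ‖w‖

lemma truncNormRpow_nonneg (p M : ℝ) (w : ℂ) : 0 ≤ truncNormRpow p M w :=
  Set.indicator_apply_nonneg fun _ => by positivity

lemma integrable_truncNormRpow {p M : ℝ} (hp : p < 2) (hM : 0 < M) :
    Integrable (truncNormRpow p M) := by
  have h1 : IntegrableOn (fun w : ℂ => ‖w‖ ^ (-p)) (Metric.ball 0 M) := by
    rw [integrableOn_fun_norm_addHaar volume (f := fun t : ℝ => t ^ (-p)),
      Complex.finrank_real_complex]
    refine ((intervalIntegral.integrableOn_Ioo_rpow_iff hM (s := 1 - p)).2 (by linarith)).congr_fun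
      (fun y hy => ?_) measurableSet_Ioo
    change y ^ (1 - p) = y ^ (2 - 1) • y ^ (-p)
    rw [sub_eq_add_neg, Real.rpow_add hy.1, Real.rpow_one]
    simp
  rw [← integrable_indicator_iff measurableSet_ball] at h1
  refine h1.congr (.of_forall fun w => ?_)
  simp only [truncNormRpow, Set.indicator, mem_ball_zero_iff, Set.mem_Iio]

lemma integral_truncNormRpow {p M : ℝ} (hp : p < 2) (hM : 0 < M) :
    ∫ w, truncNormRpow p M w = 2 * Real.pi / (2 - p) * M ^ (2 - p) := by
  have hball : (volume : Measure ℂ).real (Metric.ball 0 1) = Real.pi := by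
    simp [Measure.real, Complex.volume_ball]
  have hrad : ∫ y in Set.Ioi (0 : ℝ), y ^ (2 - 1) • (Set.Iio M).indicator (fun t => t ^ (-p)) y =
      M ^ (2 - p) / (2 - p) := by
    have h1 : ∀ y ∈ Set.Ioi (0 : ℝ), y ^ (2 - 1) • (Set.Iio M).indicator (fun t => t ^ (-p)) y =
        (Set.Iio M).indicator (fun t => t ^ (1 - p)) y := fun y hy => by
      by_cases hyM : y ∈ Set.Iio M
      · rw [Set.indicator_of_mem hyM, Set.indicator_of_mem hyM, sub_eq_add_neg 1 p,
          Real.rpow_add hy, Real.rpow_one]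
        simp
      · rw [Set.indicator_of_notMem hyM, Set.indicator_of_notMem hyM, smul_zero]
    rw [setIntegral_congr_fun measurableSet_Ioi h1, setIntegral_indicator measurableSet_Iio,
      Set.Ioi_inter_Iio, ← integral_Ioc_eq_integral_Ioo, ← intervalIntegral.integral_of_le hM.le,
      integral_rpow (Or.inl (by linarith)), Real.zero_rpow (by linarith)]
    rw [sub_zero, show 1 - p + 1 = 2 - p by ring]
  unfold truncNormRpow
  rw [integral_fun_norm_addHaar volume ((Set.Iio M).indicator fun t : ℝ => t ^ (-p)),
    Complex.finrank_real_complex, hrad, hball]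
  simp only [nsmul_eq_mul, smul_eq_mul]
  push_cast
  ring

/-- Vectors whose entries are nonzero and bounded by `M`, with a product smaller than `s`. -/
def smallProductSet (N : ℕ) (M s : ℝ) : Set (Fin N → ℂ) :=
  {w | (∀ j, w j ≠ 0 ∧ ‖w j‖ < M) ∧ ∏ j, ‖w j‖ < s}

lemma isOpen_smallProductSet (N : ℕ) (M s : ℝ) : IsOpen (smallProductSet N M s) := by
  have h1 : IsOpen {w : Fin N → ℂ | ∀ j, w j ≠ 0 ∧ ‖w j‖ < M} := by
    simp only [Set.ofPred_forall]
    refine isOpen_iInter_of_finite fun j => ?_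
    exact (isOpen_ne_fun (continuous_apply j) continuous_const).inter
      (isOpen_lt (continuous_apply j).norm continuous_const)
  exact h1.inter (isOpen_lt (continuous_finsetProd _ fun j _ => (continuous_apply j).norm)
    continuous_const)

/-- Markov's inequality for `∏ ‖w j‖ ^ (-p)`, where `p < 2` makes each factor integrable. -/
lemma volume_smallProductSet_le (N : ℕ) {p M s : ℝ} (hp0 : 0 ≤ p) (hp : p < 2) (hM : 0 < M)
    (hs : 0 < s) :
    volume (smallProductSet N M s) ≤
      ENNReal.ofReal (s ^ p * (2 * Real.pi / (2 - p) * M ^ (2 - p)) ^ N) := by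
  set G : (Fin N → ℂ) → ℝ := fun w => ∏ j, truncNormRpow p M (w j) with hG
  have hGi : Integrable G := Integrable.fintype_prod fun _ => integrable_truncNormRpow hp hM
  have hGn : 0 ≤ᵐ[volume] G := .of_forall fun w =>
    Finset.prod_nonneg fun j _ => truncNormRpow_nonneg p M (w j)
  have hint : ∫ w, G w = (2 * Real.pi / (2 - p) * M ^ (2 - p)) ^ N := by
    rw [hG, integral_fintype_prod_volume_eq_prod]
    simp [integral_truncNormRpow hp hM]
  have hsub : smallProductSet N M s ⊆ {w | s ^ (-p) ≤ G w} := by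
    rintro w ⟨h1, h2⟩
    have h3 : G w = (∏ j, ‖w j‖) ^ (-p) := by
      rw [← Real.finsetProd_rpow _ _ fun j _ => norm_nonneg _]
      refine Finset.prod_congr rfl fun j _ => ?_
      rw [truncNormRpow, Set.indicator_of_mem (Set.mem_Iio.2 (h1 j).2)]
    have h4 : 0 < ∏ j, ‖w j‖ := Finset.prod_pos fun j _ => norm_pos_iff.2 (h1 j).1
    simp only [Set.mem_ofPred_eq, h3]
    exact Real.rpow_le_rpow_of_nonpos h4 h2.le (by linarith)
  have hmarkov := mul_meas_ge_le_integral_of_nonneg hGn hGi (s ^ (-p))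
  have hfin : volume {w | s ^ (-p) ≤ G w} ≠ ⊤ :=
    (hGi.measure_ge_lt_top (by positivity)).ne
  refine (measure_mono hsub).trans ?_
  rw [ENNReal.le_ofReal_iff_toReal_le hfin (by
    have := Real.pi_pos
    have : 0 < 2 - p := by linarith
    positivity)]
  rw [hint, Real.rpow_neg hs.le, inv_mul_le_iff₀ (by positivity), ← Real.rpow_neg hs.le] at hmarkov
  exact hmarkov

end Volume

/-! ### Affine images of Gaussian vectors -/

section Affine

lemma pi_stdComplexGaussian_le (N : ℕ) [SigmaFinite stdComplexGaussian] (s : Set (Fin N → ℂ)) :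
    ENNReal.ofReal (Real.pi ^ N) * Measure.pi (fun _ : Fin N => stdComplexGaussian) s ≤
      volume s := by
  have h : (ENNReal.ofReal (Real.pi ^ N) •
      Measure.pi (fun _ : Fin N => stdComplexGaussian)).toOuterMeasure ≤
      OuterMeasure.pi fun _ : Fin N => (volume : Measure ℂ).toOuterMeasure := by
    rw [OuterMeasure.le_pi]
    intro t _
    have h2 : ∀ i, ENNReal.ofReal Real.pi * stdComplexGaussian (t i) ≤ volume (t i) := fun i =>
      calc _ ≤ ENNReal.ofReal Real.pi * stdComplexGaussian (toMeasurable volume (t i)) := by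
            gcongr; exact subset_toMeasurable _ _
        _ ≤ _ := stdComplexGaussian_apply_le _ (measurableSet_toMeasurable _ _)
        _ = _ := measure_toMeasurable _
    change ENNReal.ofReal (Real.pi ^ N) •
      Measure.pi (fun _ : Fin N => stdComplexGaussian) (Set.univ.pi t) ≤ ∏ i, volume (t i)
    rw [Measure.pi_pi, smul_eq_mul, ENNReal.ofReal_pow Real.pi_pos.le]
    calc _ = ∏ i, ENNReal.ofReal Real.pi * stdComplexGaussian (t i) := by
          rw [Finset.prod_mul_distrib]; simp
      _ ≤ _ := Finset.prod_le_prod' fun i _ => h2 i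
  calc _ ≤ ENNReal.ofReal (Real.pi ^ N) * Measure.pi (fun _ : Fin N => stdComplexGaussian)
          (toMeasurable volume s) := by gcongr; exact subset_toMeasurable _ _
    _ ≤ (OuterMeasure.pi fun _ : Fin N => (volume : Measure ℂ).toOuterMeasure)
          (toMeasurable volume s) := h _
    _ = volume (toMeasurable volume s) := by
        rw [volume_pi, Measure.pi, toMeasure_apply _ _ (measurableSet_toMeasurable _ _)]
    _ = _ := measure_toMeasurable _

/-- The density of a Gaussian vector is at most `π ^ (-N)`, and a complex linear map
with determinant `d` scales volumes by `‖d‖ ^ 2`. -/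
lemma pi_stdComplexGaussian_affine_preimage_le {N : ℕ} [SigmaFinite stdComplexGaussian]
    {U : Matrix (Fin N) (Fin N) ℂ} (hU : U.det ≠ 0) (b : Fin N → ℂ) (S : Set (Fin N → ℂ)) :
    Measure.pi (fun _ : Fin N => stdComplexGaussian) {x | U.mulVec x + b ∈ S} ≤
      ENNReal.ofReal ((Real.pi ^ N * ‖U.det‖ ^ 2)⁻¹) * volume S := by
  have hvol : volume {x | U.mulVec x + b ∈ S} = ENNReal.ofReal ((‖U.det‖ ^ 2)⁻¹) * volume S := by
    set L : (Fin N → ℂ) →ₗ[ℝ] (Fin N → ℂ) := (Matrix.toLin' U).restrictScalars ℝ with hL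
    have hdet : LinearMap.det L = ‖U.det‖ ^ 2 := by
      rw [hL, LinearMap.det_restrictScalars, LinearMap.det_toLin', Algebra.norm_complex_apply,
        Complex.normSq_eq_norm_sq]
    have hdet0 : LinearMap.det L ≠ 0 := by
      rw [hdet]; simpa using hU
    have hset : {x | U.mulVec x + b ∈ S} = L ⁻¹' ((fun w => w + b) ⁻¹' S) := by
      ext x; simp [hL]
    rw [hset, Measure.addHaar_preimage_linearMap _ hdet0, measure_preimage_add_right, hdet,
      abs_of_nonneg (by positivity)]
  have h := pi_stdComplexGaussian_le N {x | U.mulVec x + b ∈ S}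
  rw [hvol] at h
  have hpi : (0 : ℝ) < Real.pi ^ N := by positivity
  rw [mul_inv, ENNReal.ofReal_mul (by positivity), ENNReal.ofReal_inv_of_pos hpi, mul_assoc]
  rwa [ENNReal.mul_le_iff_le_inv (by simpa using hpi) (by simp)] at h

end Affine

/-! ### The interpolation matrix -/

section Interpolation

lemma two_pow_mul_factorial_le (k : ℕ) : (2 : ℝ) ^ k * k.factorial ≤ (k + 1 : ℝ) ^ k := by
  induction k with
  | zero => simp
  | succ k ih =>
    have hk : (0 : ℝ) < k + 1 := by positivity
    have h1 : 1 + ((k + 1 : ℕ) : ℝ) * (1 / (k + 1)) ≤ (1 + 1 / (k + 1 : ℝ)) ^ (k + 1) :=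
      one_add_mul_le_pow (le_trans (by norm_num) (show (0 : ℝ) ≤ 1 / (k + 1) by positivity)) _
    have h2 : 1 + ((k + 1 : ℕ) : ℝ) * (1 / (k + 1)) = 2 := by
      push_cast; field_simp; norm_num
    rw [h2] at h1
    calc (2 : ℝ) ^ (k + 1) * (k + 1).factorial = 2 * (k + 1) * (2 ^ k * k.factorial) := by
          rw [Nat.factorial_succ]; push_cast; ring
      _ ≤ 2 * (k + 1) * (k + 1) ^ k := by gcongr
      _ = 2 * (k + 1) ^ (k + 1) := by ring
      _ ≤ (1 + 1 / (k + 1 : ℝ)) ^ (k + 1) * (k + 1) ^ (k + 1) := by gcongr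
      _ = _ := by
          rw [← mul_pow]; congr 1; push_cast; field_simp

lemma two_pow_le_pow_div_factorial {N k : ℕ} (hk : k < 2 * N) :
    (2 : ℝ) ^ k ≤ (2 * N : ℝ) ^ k / k.factorial := by
  rw [le_div_iff₀ (by exact_mod_cast k.factorial_pos)]
  refine (two_pow_mul_factorial_le k).trans ?_
  gcongr
  exact_mod_cast hk

/-- The matrix sending `(ζ_N, …, ζ_{2N-1})` to the values of the corresponding part of `ψ`
at the points `ρ ξ ^ j`. -/
noncomputable def blockMatrix (N : ℕ) (ρ : ℝ) (ξ : ℂ) : Matrix (Fin N) (Fin N) ℂ :=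
  Matrix.of fun j i =>
    (ρ * ξ ^ (j : ℕ)) ^ (N + (i : ℕ)) / ((Real.sqrt ((N + i : ℕ).factorial : ℝ) : ℝ) : ℂ)

lemma norm_det_vandermonde_primitiveRoot {N : ℕ} (hN : N ≠ 0) {ξ : ℂ} (hξ : IsPrimitiveRoot ξ N) :
    ‖(Matrix.vandermonde fun j : Fin N => ξ ^ (j : ℕ)).det‖ ^ 2 = (N : ℝ) ^ N := by
  have hξ1 : ‖ξ‖ = 1 := hξ.norm'_eq_one hN
  have hconj : star ξ * ξ = 1 := by
    have := Complex.conj_mul' ξ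
    rw [hξ1] at this
    simpa using this
  set V := Matrix.vandermonde fun j : Fin N => ξ ^ (j : ℕ) with hV
  have hVV : V.conjTranspose * V = (N : ℂ) • (1 : Matrix (Fin N) (Fin N) ℂ) := by
    ext i l
    have h1 : (V.conjTranspose * V) i l =
        ∑ j ∈ Finset.range N, (star ξ ^ (i : ℕ) * ξ ^ (l : ℕ)) ^ j := by
      rw [← Fin.sum_univ_eq_sum_range (fun j => (star ξ ^ (i : ℕ) * ξ ^ (l : ℕ)) ^ j)]
      simp only [Matrix.mul_apply, Matrix.conjTranspose_apply, hV, Matrix.vandermonde_apply]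
      refine Finset.sum_congr rfl fun j _ => ?_
      rw [star_pow, star_pow, mul_pow, ← pow_mul, ← pow_mul, ← pow_mul, ← pow_mul,
        mul_comm (i : ℕ), mul_comm (l : ℕ)]
    rw [h1]
    by_cases hil : i = l
    · subst hil
      rw [← mul_pow, hconj]
      simp
    · have hne : star ξ ^ (i : ℕ) * ξ ^ (l : ℕ) ≠ 1 := by
        intro h
        apply hil
        have h2 : ξ ^ (l : ℕ) = ξ ^ (i : ℕ) := by
          calc ξ ^ (l : ℕ) = (star ξ * ξ) ^ (i : ℕ) * ξ ^ (l : ℕ) := by rw [hconj]; simp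
            _ = ξ ^ (i : ℕ) * (star ξ ^ (i : ℕ) * ξ ^ (l : ℕ)) := by rw [mul_pow]; ring
            _ = _ := by rw [h, mul_one]
        exact Fin.ext (hξ.pow_inj i.2 l.2 h2.symm)
      have hone : (star ξ ^ (i : ℕ) * ξ ^ (l : ℕ)) ^ N = 1 := by
        rw [mul_pow, ← pow_mul, ← pow_mul, mul_comm, mul_comm (l : ℕ), mul_comm (i : ℕ), pow_mul,
          pow_mul, ← star_pow, hξ.pow_eq_one]
        simp
      rw [geom_sum_eq hne, hone]
      simp [hil]
  have hdet := congrArg Matrix.det hVV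
  rw [Matrix.det_mul, Matrix.det_conjTranspose, Matrix.det_smul, Matrix.det_one] at hdet
  have := congrArg norm hdet
  simp only [norm_mul, norm_star, norm_pow, Complex.norm_natCast, Fintype.card_fin, mul_one] at this
  rw [sq]; exact this

/-- At `ρ² = 2N` the matrix has a large determinant: its columns are multiples of orthogonal
vectors of length `√N` by factors of modulus at least `2 ^ (N / 2)`. -/
lemma le_norm_det_blockMatrix {N : ℕ} (hN : N ≠ 0) {ρ : ℝ} (hρ : ρ ^ 2 = 2 * N)
    {ξ : ℂ} (hξ : IsPrimitiveRoot ξ N) :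
    ((N : ℝ) * 2 ^ N) ^ N ≤ ‖(blockMatrix N ρ ξ).det‖ ^ 2 := by
  set d : Fin N → ℂ := fun i =>
    (ρ : ℂ) ^ (N + (i : ℕ)) / ((Real.sqrt ((N + i : ℕ).factorial : ℝ) : ℝ) : ℂ) with hd
  have hfac : blockMatrix N ρ ξ =
      (Matrix.vandermonde fun j : Fin N => ξ ^ (j : ℕ)) * Matrix.diagonal d := by
    ext j i
    rw [Matrix.mul_diagonal]
    simp only [blockMatrix, Matrix.of_apply, Matrix.vandermonde_apply, hd, mul_pow]
    -- As `ξ ^ N = 1`, the shift of the exponents by `N` is invisible to the Vandermonde part.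
    have : (ξ ^ (j : ℕ)) ^ (N + (i : ℕ)) = (ξ ^ (j : ℕ)) ^ (i : ℕ) := by
      rw [pow_add, ← pow_mul, mul_comm (j : ℕ), pow_mul, hξ.pow_eq_one, one_pow, one_mul]
    rw [this]; ring
  have hdi : ∀ i, (2 : ℝ) ^ N ≤ ‖d i‖ ^ 2 := fun i => by
    have h1 : ‖d i‖ ^ 2 = (2 * N : ℝ) ^ (N + (i : ℕ)) / (N + i : ℕ).factorial := by
      rw [hd]
      simp only [norm_div, norm_pow, Complex.norm_real, Real.norm_eq_abs, div_pow, sq_abs]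
      rw [Real.sq_sqrt (by positivity), ← pow_mul, mul_comm _ 2, pow_mul, sq_abs, hρ]
    rw [h1]
    refine le_trans ?_ (two_pow_le_pow_div_factorial (by omega))
    exact pow_le_pow_right₀ (by norm_num) (by omega)
  rw [hfac, Matrix.det_mul, Matrix.det_diagonal, norm_mul, mul_pow, mul_pow,
    norm_det_vandermonde_primitiveRoot hN hξ, norm_prod, ← Finset.prod_pow]
  gcongr
  calc ((2 : ℝ) ^ N) ^ N = ∏ _i : Fin N, (2 : ℝ) ^ N := by simp
    _ ≤ _ := Finset.prod_le_prod (fun _ _ => by positivity) fun i _ => hdi i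

end Interpolation

/-! ### The small-ball estimate for the values of `ψ` -/

section SmallBall

variable {Ω : Type*} [MeasurableSpace Ω] {P : Measure Ω} [IsProbabilityMeasure P]
  {ζ : ℕ → Ω → ℂ}

lemma isProbabilityMeasure_stdComplexGaussian (hζ : ∀ k, HasLaw (ζ k) stdComplexGaussian P) :
    IsProbabilityMeasure stdComplexGaussian :=
  (hζ 0).map_eq ▸ Measure.isProbabilityMeasure_map (hζ 0).aemeasurable

/-- Conditioning on the coefficients outside the block `N ≤ k < 2N` only translates the
vector of values, which does not affect the bound. -/
lemma measure_partialSum_mem_le (hζ : ∀ k, HasLaw (ζ k) stdComplexGaussian P)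
    (hind : iIndepFun ζ P) {N : ℕ} {ρ : ℝ} {ξ : ℂ} (hdet : (blockMatrix N ρ ξ).det ≠ 0)
    {S : Set (Fin N → ℂ)} (hS : MeasurableSet S) (n : ℕ) :
    P {ω | (fun j : Fin N => ∑ k ∈ Finset.range (2 * N + n), psiTerm ζ ω (ρ * ξ ^ (j : ℕ)) k) ∈ S} ≤
      ENNReal.ofReal ((Real.pi ^ N * ‖(blockMatrix N ρ ξ).det‖ ^ 2)⁻¹) * volume S := by
  have hprob := isProbabilityMeasure_stdComplexGaussian hζ
  set I := Finset.Ico N (2 * N) with hI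
  set J := Finset.range (2 * N + n) \ I with hJ
  set X : Ω → Fin N → ℂ := fun ω i => ζ (N + i) ω with hX
  set Y : Ω → Fin N → ℂ := fun ω j => ∑ k ∈ J, psiTerm ζ ω (ρ * ξ ^ (j : ℕ)) k with hY
  have hXlaw : HasLaw X (Measure.pi fun _ : Fin N => stdComplexGaussian) P :=
    (hind.precomp (g := fun i : Fin N => N + (i : ℕ))
      (fun a b h => Fin.ext (by simpa using h))).hasLaw_pi fun i => hζ _
  have hYm : AEMeasurable Y P := by
    rw [aemeasurable_pi_iff]
    exact fun j => Finset.aemeasurable_fun_sum _ fun k _ => aemeasurable_psiTerm hζ _ k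
  have hXY : IndepFun X Y P := by
    have h := hind.indepFun_finset₀ I J Finset.disjoint_sdiff fun k => (hζ k).aemeasurable
    exact h.comp
      (φ := fun (x : I → ℂ) (i : Fin N) => x ⟨N + i, by rw [hI, Finset.mem_Ico]; omega⟩)
      (ψ := fun (y : J → ℂ) (j : Fin N) => ∑ k ∈ J.attach, y k *
        ((ρ * ξ ^ (j : ℕ)) ^ (k : ℕ) / ((Real.sqrt ((k : ℕ).factorial : ℝ) : ℝ) : ℂ)))
      (by fun_prop) (by fun_prop) |>.congr (by rfl) (by
        refine .of_forall fun ω => ?_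
        ext j
        simp only [Function.comp_apply, hY]
        exact Finset.sum_attach J fun k => psiTerm ζ ω (ρ * ξ ^ (j : ℕ)) k)
  have hsplit : ∀ ω, (fun j : Fin N => ∑ k ∈ Finset.range (2 * N + n),
      psiTerm ζ ω (ρ * ξ ^ (j : ℕ)) k) = (blockMatrix N ρ ξ).mulVec (X ω) + Y ω := fun ω => by
    ext j
    have hIs : I ⊆ Finset.range (2 * N + n) := fun k hk => by
      rw [hI, Finset.mem_Ico] at hk
      rw [Finset.mem_range]; omega
    rw [Pi.add_apply, ← Finset.sum_sdiff hIs, add_comm]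
    congr 1
    rw [hI, Finset.sum_Ico_eq_sum_range, show 2 * N - N = N by omega,
      ← Fin.sum_univ_eq_sum_range (fun k => psiTerm ζ ω (ρ * ξ ^ (j : ℕ)) (N + k))]
    simp only [Matrix.mulVec, dotProduct, blockMatrix, Matrix.of_apply, hX, psiTerm]
    exact Finset.sum_congr rfl fun i _ => mul_comm _ _
  simp only [hsplit]
  have hmeas : MeasurableSet {q : (Fin N → ℂ) × (Fin N → ℂ) |
      (blockMatrix N ρ ξ).mulVec q.1 + q.2 ∈ S} := by
    have hc : Continuous fun q : (Fin N → ℂ) × (Fin N → ℂ) =>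
        (blockMatrix N ρ ξ).mulVec q.1 + q.2 :=
      (continuous_const.matrix_mulVec continuous_fst).add continuous_snd
    exact hc.measurable hS
  have hlaw := (indepFun_iff_map_prod_eq_prod_map_map hXlaw.aemeasurable hYm).1 hXY
  have hPY : IsProbabilityMeasure (P.map Y) := Measure.isProbabilityMeasure_map hYm
  calc P {ω | (blockMatrix N ρ ξ).mulVec (X ω) + Y ω ∈ S}
      = (P.map fun ω => (X ω, Y ω)) {q | (blockMatrix N ρ ξ).mulVec q.1 + q.2 ∈ S} := by
        rw [Measure.map_apply_of_aemeasurable (hXlaw.aemeasurable.prodMk hYm) hmeas]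
        rfl
    _ = ∫⁻ y, Measure.pi (fun _ : Fin N => stdComplexGaussian)
          {x | (blockMatrix N ρ ξ).mulVec x + y ∈ S} ∂P.map Y := by
        rw [hlaw, hXlaw.map_eq, Measure.prod_apply_symm hmeas]
        rfl
    _ ≤ ∫⁻ _, ENNReal.ofReal ((Real.pi ^ N * ‖(blockMatrix N ρ ξ).det‖ ^ 2)⁻¹) * volume S
          ∂P.map Y :=
        lintegral_mono fun y => pi_stdComplexGaussian_affine_preimage_le hdet y S
    _ = _ := by simp

lemma measure_psi_values_mem_le (hζ : ∀ k, HasLaw (ζ k) stdComplexGaussian P)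
    (hind : iIndepFun ζ P) {N : ℕ} {ρ : ℝ} {ξ : ℂ} (hdet : (blockMatrix N ρ ξ).det ≠ 0)
    {S : Set (Fin N → ℂ)} (hS : IsOpen S) :
    P {ω | (∀ z, Summable (psiTerm ζ ω z)) ∧ (fun j : Fin N => psi ζ ω (ρ * ξ ^ (j : ℕ))) ∈ S} ≤
      ENNReal.ofReal ((Real.pi ^ N * ‖(blockMatrix N ρ ξ).det‖ ^ 2)⁻¹) * volume S := by
  set E : ℕ → Set Ω := fun n => {ω | (fun j : Fin N =>
    ∑ k ∈ Finset.range (2 * N + n), psiTerm ζ ω (ρ * ξ ^ (j : ℕ)) k) ∈ S} with hE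
  -- As `S` is open, eventually all partial sums lie in `S`.
  have hmono : Monotone fun m => ⋂ n ≥ m, E n := fun a b hab =>
    Set.biInter_subset_biInter_left fun n hn => le_trans hab hn
  have hsub : {ω | (∀ z, Summable (psiTerm ζ ω z)) ∧
      (fun j : Fin N => psi ζ ω (ρ * ξ ^ (j : ℕ))) ∈ S} ⊆ ⋃ m, ⋂ n ≥ m, E n := by
    rintro ω ⟨hs, hω⟩
    have hlim : Filter.Tendsto (fun n => fun j : Fin N =>
        ∑ k ∈ Finset.range (2 * N + n), psiTerm ζ ω (ρ * ξ ^ (j : ℕ)) k) Filter.atTop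
        (nhds fun j : Fin N => psi ζ ω (ρ * ξ ^ (j : ℕ))) := by
      rw [tendsto_pi_nhds]
      intro j
      have h := (hs (ρ * ξ ^ (j : ℕ))).hasSum.tendsto_sum_nat
      simp only [add_comm (2 * N)]
      exact h.comp (Filter.tendsto_add_atTop_nat (2 * N))
    obtain ⟨m, hm⟩ := Filter.eventually_atTop.1 (hlim (hS.mem_nhds hω))
    simp only [Set.mem_iUnion, Set.mem_iInter]
    exact ⟨m, hm⟩
  refine (measure_mono hsub).trans ?_
  rw [hmono.measure_iUnion]
  exact iSup_le fun m => (measure_mono (Set.biInter_subset_of_mem (Set.mem_ofPred.2 le_rfl))).trans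
    (measure_partialSum_mem_le hζ hind hdet hS.measurableSet m)

end SmallBall

/-! ### The upper bound -/

section UpperBound

variable {Ω : Type*} {ζ : ℕ → Ω → ℂ}

lemma mul_le_two_pow {N : ℕ} (hN : 12 ≤ N) : 292 * N ≤ 2 ^ N := by
  induction N, hN using Nat.le_induction with
  | base => norm_num
  | succ n hn ih => rw [pow_succ]; omega

/-- On the hole event, with moderate coefficients, the vector of values at the `N` points
`ρ ξ ^ j` lies in a set of small volume. -/
lemma psi_values_mem_smallProductSet {N : ℕ} (hN : 12 ≤ N) {ρ : ℝ} (hρ0 : 0 < ρ)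
    (hρ : ρ ^ 2 = 2 * N) {ξ : ℂ} (hξ : IsPrimitiveRoot ξ N) {ω : Ω}
    (hω : ω ∈ holeEvent ζ (4 * ρ)) (hc : ∀ k, ‖ζ k ω‖ ≤ 2 * N * (3 / 2) ^ k) :
    (fun j : Fin N => psi ζ ω (ρ * ξ ^ (j : ℕ))) ∈
      smallProductSet N (9 * N * Real.exp (4 * N)) ((6 * N) ^ N) := by
  have hN0 : N ≠ 0 := by omega
  have hNpos : (0 : ℝ) < N := by positivity
  have hξ1 : ‖ξ‖ = 1 := hξ.norm'_eq_one hN0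
  have hbound : ∀ a : ℝ, ∀ z : ℂ, 2 * ‖z‖ ^ 2 ≤ a → ‖psi ζ ω z‖ < 9 * N * Real.exp a :=
    fun a z hz => by
      refine (norm_psi_le hc z).trans_lt ?_
      have h1 : Real.exp (2 * ‖z‖ ^ 2) ≤ Real.exp a := Real.exp_le_exp.2 hz
      have h2 := mul_le_mul_of_nonneg_left h1 hNpos.le
      have h3 := mul_pos hNpos (Real.exp_pos a)
      linarith
  have hz : ∀ j : ℕ, ‖(ρ * ξ ^ j : ℂ)‖ = ρ := fun j => by simp [hξ1, abs_of_pos hρ0]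
  have hne : ∀ j : ℕ, psi ζ ω (ρ * ξ ^ j) ≠ 0 := fun j => hω _ (by rw [hz]; linarith)
  refine ⟨fun j => ⟨hne j, hbound _ _ ?_⟩, ?_⟩
  · rw [hz, hρ]; linarith
  have hlog := sum_log_norm_le_of_ne_zero
    (differentiable_psi fun z => summable_psiTerm_of_norm_le hc z) hρ0 (fun z hz => hω z hz)
    (M := 9 * N * Real.exp (64 * N)) (fun z hz => hbound _ z (by
      have : ‖z‖ ^ 2 ≤ (4 * ρ) ^ 2 := by gcongr
      rw [mul_pow, hρ] at this
      linarith)) hN0 hξ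
  have h0 : 0 < ‖psi ζ ω 0‖ := norm_pos_iff.2 (hω 0 (by simp; positivity))
  have h0log : Real.log ‖psi ζ ω 0‖ ≤ Real.log (2 * N) := by
    apply Real.log_le_log h0
    rw [psi_zero]
    simpa using hc 0
  have hpow : 292 * (N : ℝ) ≤ 2 ^ N := by exact_mod_cast mul_le_two_pow hN
  set δ : ℝ := 4 * (1 / 2) ^ N with hδ
  have hδ0 : 0 < δ := by positivity
  have hδN : δ * (73 * N) ≤ 1 := by
    rw [hδ, one_div, inv_pow, show 4 * ((2 : ℝ) ^ N)⁻¹ * (73 * N) = 292 * N / 2 ^ N by ring]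
    exact (div_le_one (by positivity)).2 hpow
  -- With `δ ≤ 1` only upper bounds for `log ‖ψ 0‖` are needed: its coefficient is `1 - δ`.
  have hδ1 : δ ≤ 1 := by
    have : (1 : ℝ) ≤ 73 * N := by
      have : (12 : ℝ) ≤ N := by exact_mod_cast hN
      linarith
    nlinarith
  have hlogM : Real.log (9 * N * Real.exp (64 * N)) ≤ 73 * N := by
    rw [Real.log_mul (by positivity) (Real.exp_ne_zero _), Real.log_exp]
    have := Real.log_le_sub_one_of_pos (show (0 : ℝ) < 9 * N by positivity)
    linarith
  have hlog2N : 0 ≤ Real.log (2 * N) := by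
    apply Real.log_nonneg
    have : (12 : ℝ) ≤ N := by exact_mod_cast hN
    linarith
  have hmean : Real.log ‖psi ζ ω 0‖ + δ * (Real.log (9 * N * Real.exp (64 * N)) -
      Real.log ‖psi ζ ω 0‖) ≤ Real.log (2 * N) + 1 := by
    have h1 := mul_le_mul_of_nonneg_left h0log (sub_nonneg.2 hδ1)
    have h2 := mul_le_mul_of_nonneg_left hlogM hδ0.le
    have h3 := mul_nonneg hδ0.le hlog2N
    linarith
  have hlt : Real.log (2 * N) + 1 < Real.log (6 * N) := by
    have h6 : Real.log (6 * N) = Real.log 3 + Real.log (2 * N) := by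
      rw [← Real.log_mul (by norm_num) (by positivity)]
      ring_nf
    have : 1 < Real.log 3 := by
      rw [Real.lt_log_iff_exp_lt (by norm_num)]
      linarith [Real.exp_one_lt_d9]
    linarith
  have hfin : ∑ j ∈ Finset.range N, Real.log ‖psi ζ ω (ρ * ξ ^ j)‖ < N * Real.log (6 * N) := by
    refine hlog.trans_lt ?_
    have := hmean.trans_lt hlt
    gcongr
  have hprod : ∏ j : Fin N, ‖psi ζ ω (ρ * ξ ^ (j : ℕ))‖ =
      Real.exp (∑ j ∈ Finset.range N, Real.log ‖psi ζ ω (ρ * ξ ^ j)‖) := by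
    rw [Real.exp_sum, ← Fin.prod_univ_eq_prod_range
      (fun j => Real.exp (Real.log ‖psi ζ ω (ρ * ξ ^ j)‖))]
    exact Finset.prod_congr rfl fun j _ => (Real.exp_log (norm_pos_iff.2 (hne j))).symm
  rw [hprod]
  calc _ < Real.exp (N * Real.log (6 * N)) := Real.exp_lt_exp.2 hfin
    _ = _ := by rw [Real.exp_nat_mul, Real.exp_log (by positivity)]

/-- The exponents per point: `2/5` from the large values against `log 2` from the determinant. -/
lemma smallBall_constant_le {N : ℕ} (hN : 100000 ≤ N) {D : ℝ} (hD : ((N : ℝ) * 2 ^ N) ^ N ≤ D) :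
    (Real.pi ^ N * D)⁻¹ * (((6 * N : ℝ) ^ N) ^ (19 / 10 : ℝ) *
      (2 * Real.pi / (2 - 19 / 10) * (9 * N * Real.exp (4 * N)) ^ (2 - 19 / 10 : ℝ)) ^ N) ≤
      Real.exp (-(N ^ 2 / 10 : ℝ)) := by
  have hNr : (100000 : ℝ) ≤ N := by exact_mod_cast hN
  have hNpos : (0 : ℝ) < N := by linarith
  have hpi := Real.pi_pos
  have hbase : 20 * ((6 * N : ℝ) ^ (19 / 10 : ℝ) * (9 * N * Real.exp (4 * N)) ^ (1 / 10 : ℝ)) ≤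
      N * 2 ^ N * Real.exp (-(N / 10 : ℝ)) := by
    have h1 : (6 * N : ℝ) ^ (19 / 10 : ℝ) * (9 * N * Real.exp (4 * N)) ^ (1 / 10 : ℝ) ≤
        (9 * N) ^ 2 * Real.exp (2 / 5 * N) := by
      rw [Real.mul_rpow (by positivity) (Real.exp_pos _).le, ← Real.exp_mul, ← mul_assoc,
        show 4 * (N : ℝ) * (1 / 10) = 2 / 5 * N by ring]
      gcongr
      calc (6 * N : ℝ) ^ (19 / 10 : ℝ) * (9 * N) ^ (1 / 10 : ℝ)
          ≤ (9 * N : ℝ) ^ (19 / 10 : ℝ) * (9 * N) ^ (1 / 10 : ℝ) := by gcongr; norm_num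
        _ = (9 * N) ^ 2 := by
            rw [← Real.rpow_add (by positivity), ← Real.rpow_natCast]; norm_num
    have h2 : Real.exp (69 / 100 * N) ≤ 2 ^ N := by
      rw [← Real.exp_log (show (0 : ℝ) < 2 ^ N by positivity), Real.log_pow]
      apply Real.exp_le_exp.2
      nlinarith [Real.log_two_gt_d9]
    -- This step dictates the size of `N`; the constant is `20 * 9 ^ 2`.
    have h3 : 1620 * (N : ℝ) ≤ Real.exp (19 / 100 * N) := by
      have := Real.quadratic_le_exp_of_nonneg (show 0 ≤ 19 / 100 * (N : ℝ) by positivity)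
      nlinarith
    calc _ ≤ 20 * ((9 * N) ^ 2 * Real.exp (2 / 5 * N)) := by gcongr
      _ = N * (1620 * N * Real.exp (2 / 5 * N)) := by ring
      _ ≤ N * (Real.exp (19 / 100 * N) * Real.exp (2 / 5 * N)) := by gcongr
      _ = N * (Real.exp (69 / 100 * N) * Real.exp (-(N / 10 : ℝ))) := by
          rw [← Real.exp_add, ← Real.exp_add]; ring_nf
      _ ≤ N * (2 ^ N * Real.exp (-(N / 10 : ℝ))) := by gcongr
      _ = _ := by ring
  rw [inv_mul_le_iff₀ (mul_pos (by positivity) (lt_of_lt_of_le (by positivity) hD))]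
  have hs : ((6 * N : ℝ) ^ N) ^ (19 / 10 : ℝ) = ((6 * N : ℝ) ^ (19 / 10 : ℝ)) ^ N := by
    rw [← Real.rpow_natCast, ← Real.rpow_natCast, ← Real.rpow_mul (by positivity),
      ← Real.rpow_mul (by positivity), mul_comm (N : ℝ) (19 / 10)]
  rw [hs, ← mul_pow]
  calc _ = (Real.pi * (20 * ((6 * N : ℝ) ^ (19 / 10 : ℝ) *
          (9 * N * Real.exp (4 * N)) ^ (1 / 10 : ℝ)))) ^ N := by
        norm_num; ring
    _ ≤ (Real.pi * (N * 2 ^ N * Real.exp (-(N / 10 : ℝ)))) ^ N := by gcongr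
    _ = Real.pi ^ N * ((N : ℝ) * 2 ^ N) ^ N * Real.exp (-(N ^ 2 / 10 : ℝ)) := by
        rw [mul_pow, mul_pow, ← Real.exp_nat_mul, ← mul_assoc]
        congr 2
        ring
    _ ≤ _ := by gcongr

variable [MeasurableSpace Ω] {P : Measure Ω} [IsProbabilityMeasure P]

/-- The hole radius is `4 ρ` with `ρ² = 2N`, twice the radius on which Cauchy's estimates for the
logarithm are used, and four times the radius of the circle carrying the `N` sample points. -/
lemma measure_holeEvent_sqrt_le (hζ : ∀ k, HasLaw (ζ k) stdComplexGaussian P)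
    (hind : iIndepFun ζ P) {N : ℕ} (hN : 100000 ≤ N) :
    P (holeEvent ζ (4 * Real.sqrt (2 * N))) ≤ ENNReal.ofReal (Real.exp (-(N ^ 2 / 20 : ℝ))) := by
  have hNr : (100000 : ℝ) ≤ N := by exact_mod_cast hN
  have hN0 : N ≠ 0 := by omega
  set ρ := Real.sqrt (2 * N) with hρdef
  have hρ0 : 0 < ρ := Real.sqrt_pos.2 (by linarith)
  have hρ : ρ ^ 2 = 2 * N := Real.sq_sqrt (by positivity)
  have hξ := Complex.isPrimitiveRoot_exp N hN0
  set ξ := Complex.exp (2 * Real.pi * Complex.I / N) with hξdef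
  have hD := le_norm_det_blockMatrix hN0 hρ hξ
  have hdet : (blockMatrix N ρ ξ).det ≠ 0 := by
    intro h
    rw [h] at hD
    have : (0 : ℝ) < ((N : ℝ) * 2 ^ N) ^ N := by positivity
    norm_num at hD
    linarith
  set M : ℝ := 9 * N * Real.exp (4 * N) with hM
  set s : ℝ := (6 * N) ^ N with hs
  have hsub : holeEvent ζ (4 * ρ) ⊆
      {ω | ∃ k, (2 * N : ℝ) * (3 / 2) ^ k < ‖ζ (0 + k) ω‖} ∪
      {ω | (∀ z, Summable (psiTerm ζ ω z)) ∧
        (fun j : Fin N => psi ζ ω (ρ * ξ ^ (j : ℕ))) ∈ smallProductSet N M s} := by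
    intro ω hω
    by_cases hc : ∀ k, ‖ζ k ω‖ ≤ 2 * N * (3 / 2) ^ k
    · exact Or.inr ⟨fun z => summable_psiTerm_of_norm_le hc z,
        psi_values_mem_smallProductSet (by omega) hρ0 hρ hξ hω hc⟩
    · left
      push Not at hc
      simpa using hc
  have h1 := measure_exists_coeff_large_le hζ 0 (T := 2 * N) (by linarith)
  have h2 := measure_psi_values_mem_le hζ hind hdet (isOpen_smallProductSet N M s)
  have h3 : ENNReal.ofReal ((Real.pi ^ N * ‖(blockMatrix N ρ ξ).det‖ ^ 2)⁻¹) *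
      volume (smallProductSet N M s) ≤ ENNReal.ofReal (Real.exp (-(N ^ 2 / 10 : ℝ))) := by
    refine (mul_le_mul_right (volume_smallProductSet_le N (p := 19 / 10) (by norm_num)
      (by norm_num) (show 0 < M by positivity) (show 0 < s by positivity)) _).trans ?_
    rw [← ENNReal.ofReal_mul (by positivity)]
    exact ENNReal.ofReal_le_ofReal (smallBall_constant_le hN hD)
  calc P (holeEvent ζ (4 * ρ)) ≤ _ := measure_mono hsub
    _ ≤ _ := measure_union_le _ _
    _ ≤ ENNReal.ofReal (4 * Real.exp (-(2 * N : ℝ) ^ 2 / 2)) +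
          ENNReal.ofReal (Real.exp (-(N ^ 2 / 10 : ℝ))) := add_le_add h1 (h2.trans h3)
    _ = ENNReal.ofReal (4 * Real.exp (-(2 * N : ℝ) ^ 2 / 2) + Real.exp (-(N ^ 2 / 10 : ℝ))) :=
        (ENNReal.ofReal_add (by positivity) (by positivity)).symm
    _ ≤ _ := by
        apply ENNReal.ofReal_le_ofReal
        have h4 : Real.exp (-(2 * N : ℝ) ^ 2 / 2) ≤ Real.exp (-(N ^ 2 / 10 : ℝ)) := by
          apply Real.exp_le_exp.2; nlinarith
        have h5 : 5 * Real.exp (-(N ^ 2 / 10 : ℝ)) ≤ Real.exp (-(N ^ 2 / 20 : ℝ)) := by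
          rw [show -(N ^ 2 / 20 : ℝ) = N ^ 2 / 20 + -(N ^ 2 / 10) by ring, Real.exp_add]
          gcongr
          have := Real.add_one_le_exp ((N : ℝ) ^ 2 / 20)
          nlinarith
        linarith

lemma measure_holeEvent_le (hζ : ∀ k, HasLaw (ζ k) stdComplexGaussian P)
    (hind : iIndepFun ζ P) {r : ℝ} (hr : 2000 ≤ r) :
    P (holeEvent ζ r) ≤ ENNReal.ofReal (Real.exp (-(1 / 81920) * r ^ 4)) := by
  have hr2 : 4000000 ≤ r ^ 2 := by nlinarith
  set N := ⌊r ^ 2 / 32⌋₊ with hN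
  have hN1 : (N : ℝ) ≤ r ^ 2 / 32 := Nat.floor_le (by positivity)
  have hN2 : r ^ 2 / 32 < N + 1 := Nat.lt_floor_add_one _
  have hN3 : 100000 ≤ N := Nat.le_floor (by push_cast; linarith)
  have hN4 : r ^ 2 / 64 ≤ N := by linarith
  have hsub : holeEvent ζ r ⊆ holeEvent ζ (4 * Real.sqrt (2 * N)) := fun ω hω z hz => by
    refine hω z (hz.trans ?_)
    have h1 : Real.sqrt (2 * N) ≤ r / 4 := by
      apply Real.sqrt_le_iff.2
      constructor
      · linarith
      · linarith [show (r / 4) ^ 2 = r ^ 2 / 16 by ring]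
    linarith
  refine (measure_mono hsub).trans ((measure_holeEvent_sqrt_le hζ hind hN3).trans ?_)
  apply ENNReal.ofReal_le_ofReal
  apply Real.exp_le_exp.2
  have h2 : (r ^ 2 / 64) ^ 2 ≤ (N : ℝ) ^ 2 := by gcongr
  linarith [show (r ^ 2 / 64) ^ 2 = r ^ 4 / 4096 by ring]

end UpperBound

theorem theorem1 :
    ∃ c C r₀ : ℝ, 0 < c ∧ 0 < C ∧ 0 < r₀ ∧
      ∀ (Ω : Type*) [MeasurableSpace Ω] (P : Measure Ω) [IsProbabilityMeasure P]
        (ζ : ℕ → Ω → ℂ),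
        (∀ k, HasLaw (ζ k) stdComplexGaussian P) → iIndepFun ζ P →
          (∀ᵐ ω ∂P, ∀ z : ℂ, Summable (psiTerm ζ ω z)) ∧
          (∀ r : ℝ, NullMeasurableSet (holeEvent ζ r) P) ∧
          ∀ r : ℝ, r₀ ≤ r →
            Real.exp (-C * r ^ 4) ≤ holeProb P ζ r ∧
              holeProb P ζ r ≤ Real.exp (-c * r ^ 4) := by
  refine ⟨1 / 81920, 415, 2000, by norm_num, by norm_num, by norm_num, ?_⟩
  intro Ω _ P _ ζ hζ hind
  refine ⟨ae_summable_psiTerm hζ, nullMeasurableSet_holeEvent hζ, fun r hr => ⟨?_, ?_⟩⟩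
  · exact (ENNReal.ofReal_le_iff_le_toReal (measure_ne_top _ _)).1
      (exp_le_measure_holeEvent hζ hind (by linarith))
  · exact ENNReal.toReal_le_of_le_ofReal (Real.exp_pos _).le (measure_holeEvent_le hζ hind hr)
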